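/- Let $n \ge 1$ and let $\mathfrak{S}_n$ be the symmetric group on $\{1,\dots,n\}$, generated by the adjacent transpositions $s_i = (i,i+1)$, $1\le i\le n-1$; let $\ell(\sigma)$ be the least $k$ such that $\sigma$ is a product of $k$ of these generators. For $w,w'\in\mathfrak{S}_n$ write $w\to w'$ if there is a finite sequence $w=w_1,w_2,\dots,w_{k+1}=w'$ ($k\ge 0$) such that for every $i\in\{1,\dots,k\}$ there is an adjacent transposition $s$ with $w_{i+1}=s\,w_i\,s$ and $\ell(w_{i+1})\le\ell(w_i)$; write $w\approx w'$ if $w\to w'$ and $w'\to w$. This is an equivalence relation. Let $\alpha=(\alpha_1,\dots,\alpha_l)$ be a composition of $n$, that is, a finite sequence of positive integers with sum $n$. Call $\alpha$ maximal if there is a $k$ with $0\le k\le l$ such that $\alpha_i$ is even for $i\le k$, $\alpha_i$ is odd for $i>k$, and $\alpha_{k+1}\ge\alpha_{k+2}\ge\dots\ge\alpha_l$. Let $(x_1,\dots,x_n)$ be the list given by $x_{2i-1}=i$ and $x_{2i}=n-i+1$, that is, $1,n,2,n-1,\dots$. The element in stair form of $\alpha$ is the product $\sigma_\alpha=\sigma_{\alpha_1}\cdots\sigma_{\alpha_l}$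 of the disjoint cycles $$\sigma_{\alpha_i}=(x_{d_{i-1}+1},x_{d_{i-1}+2},\dots,x_{d_{i-1}+\alpha_i}),\qquad d_{i-1}=\alpha_1+\dots+\alpha_{i-1}.$$ Let $\Sigma_\alpha$ be the $\approx$-equivalence class of $\sigma_\alpha$. For $\sigma\in\mathfrak{S}_n$ let $P_e(\sigma)$ be the set of those orbits of $\sigma$ on $\{1,\dots,n\}$ that have an even number of elements. Proposition. Let $\alpha$ be a maximal composition of $n$ and let $\sigma\in\mathfrak{S}_n$. Then $\sigma\in\Sigma_\alpha$ if and only if the following three conditions hold: (1) $\sigma$ and $\sigma_\alpha$ are conjugate in $\mathfrak{S}_n$; (2) $\ell(\sigma)=\ell(\sigma_\alpha)$; (3) $P_e(\sigma)=P_e(\sigma_\alpha)$. -/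

import Mathlib

namespace CyclicShift

/-- The Coxeter generators of the symmetric group on `Fin n`: the adjacent transpositions. -/
def adjacentTranspositions (n : ℕ) : Set (Equiv.Perm (Fin n)) :=
  {s | ∃ i j : Fin n, (j : ℕ) = (i : ℕ) + 1 ∧ s = Equiv.swap i j}

/-- `l` is a word for `σ` in the Coxeter generators. -/
def IsWord {n : ℕ} (l : List (Equiv.Perm (Fin n))) (σ : Equiv.Perm (Fin n)) : Prop :=
  (∀ s ∈ l, s ∈ adjacentTranspositions n) ∧ l.prod = σ

/-- The Coxeter length: the least number of letters of a word for `σ`. -/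
noncomputable def length {n : ℕ} (σ : Equiv.Perm (Fin n)) : ℕ :=
  sInf {k : ℕ | ∃ l : List (Equiv.Perm (Fin n)), IsWord l σ ∧ l.length = k}

/-- Every permutation has a word, so that `length` is a minimum over a non-empty set. -/
theorem exists_isWord {n : ℕ} (σ : Equiv.Perm (Fin n)) :
    ∃ l : List (Equiv.Perm (Fin n)), IsWord l σ := by
  cases n with
  | zero => exact ⟨[], by simp, Subsingleton.elim _ _⟩
  | succ m =>
    have h : σ ∈ Submonoid.closure
        (Set.range fun i : Fin m => Equiv.swap i.castSucc i.succ) := by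
      rw [Equiv.Perm.mclosure_swap_castSucc_succ]
      trivial
    obtain ⟨l, hl, hp⟩ := Submonoid.exists_list_of_mem_closure h
    refine ⟨l, fun s hs => ?_, hp⟩
    obtain ⟨i, rfl⟩ := hl s hs
    exact ⟨i.castSucc, i.succ, by simp, rfl⟩

/-- One elementary step: `w' = s w s` for a generator `s`, and `ℓ(w') ≤ ℓ(w)`. -/
def Step {n : ℕ} (w w' : Equiv.Perm (Fin n)) : Prop :=
  ∃ s ∈ adjacentTranspositions n, w' = s * w * s ∧ length w' ≤ length w

/-- The cyclic shift relation `w → w'`. -/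
def Shift {n : ℕ} (w w' : Equiv.Perm (Fin n)) : Prop :=
  Relation.ReflTransGen Step w w'

/-- The equivalence relation `w ≈ w'`: both `w → w'` and `w' → w`. -/
def ShiftEquiv {n : ℕ} (w w' : Equiv.Perm (Fin n)) : Prop :=
  Shift w w' ∧ Shift w' w

/-- A composition is maximal if its first `k` parts are even and its remaining parts are odd and
weakly decreasing, for some `k`. -/
def IsMaximal {n : ℕ} (α : Composition n) : Prop :=
  ∃ k : ℕ, k ≤ α.length ∧
    (∀ i : Fin α.length, (i : ℕ) < k → Even (α.blocksFun i)) ∧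
    (∀ i : Fin α.length, k ≤ (i : ℕ) → Odd (α.blocksFun i)) ∧
    (∀ i j : Fin α.length, k ≤ (i : ℕ) → i ≤ j → α.blocksFun j ≤ α.blocksFun i)

/-- The list `1, n, 2, n - 1, …`, with both positions and entries shifted to start at `0`:
`0, n - 1, 1, n - 2, …`. -/
def stairEntry {n : ℕ} (p : Fin n) : Fin n :=
  if Even (p : ℕ) then ⟨(p : ℕ) / 2, by have := p.isLt; omega⟩
  else ⟨n - 1 - (p : ℕ) / 2, by have := p.isLt; omega⟩

/-- The cycle of the element in stair form that belongs to the `i`-th part of `α`: it runs through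
the consecutive entries of the list `stairEntry` at the positions in the `i`-th block of `α`. -/
def stairCycle {n : ℕ} (α : Composition n) (i : Fin α.length) : Equiv.Perm (Fin n) :=
  (List.ofFn fun j : Fin (α.blocksFun i) => stairEntry (α.embedding i j)).formPerm

/-- The element in stair form `σ_α`. -/
def stairForm {n : ℕ} (α : Composition n) : Equiv.Perm (Fin n) :=
  (List.ofFn (stairCycle α)).prod

/-- The class `Σ_α`: the `≈`-equivalence class of `σ_α`. -/
def stairClass {n : ℕ} (α : Composition n) : Set (Equiv.Perm (Fin n)) :=
  {σ | ShiftEquiv (stairForm α) σ}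

/-- The set of orbits of `σ` on `Fin n`. -/
def orbits {n : ℕ} (σ : Equiv.Perm (Fin n)) : Set (Set (Fin n)) :=
  Set.range fun x : Fin n => MulAction.orbit (Subgroup.zpowers σ) x

/-- The set of orbits of `σ` that have an even number of elements. -/
def evenOrbits {n : ℕ} (σ : Equiv.Perm (Fin n)) : Set (Set (Fin n)) :=
  {O ∈ orbits σ | Even O.ncard}

end CyclicShift

/-! Forward direction: along shifts between elements of equal length the length stays constant, so
an invariant of such steps suffices. It is a monotone function `f` on the entries with `f (w v) = -f
v` whose level sets are never split by an even orbit (`RespectsLevel`). Let `i`, `j` be adjacent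
with `i < j`. If `f i < f j`, then `w` and `w⁻¹` both reverse them, so conjugation by the
transposition fixes `w` or shortens it (`conj_swap_eq_or_length_lt`). If `f i = f j`, it preserves
each level set, hence each even orbit.

Converse: every `σ` is reached by shifts from the stair form of some `β` (`exists_shift_stairForm`),
which is therefore at least as long as `σ`. By conjugacy `β` rearranges `α`. The length of a stair
form depends on the order of its parts only through the sum of `2⌊a/2⌋ * b` over pairs with `a`
before `b`. An exchange argument shows that this is largest exactly when the ratio `2⌊a/2⌋ / a`
weakly decreases: even parts (ratio `1`) first, then odd parts in decreasing order. Equality of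
lengths thus gives `β` this shape, and the forward invariant gives its stair form the even orbits of
`σ`. These fix the even parts, the odd ones are sorted, so `β = α`; a shift of constant length is
reversible. -/

namespace CyclicShift

open Equiv

/-! ### Coxeter length as number of inversions -/

/-- The number of inversions of a permutation. -/
def inversionCount {n : ℕ} (w : Perm (Fin n)) : ℕ :=
  (Finset.univ.filter fun x : Fin n × Fin n => x.1 < x.2 ∧ w x.2 < w x.1).card

theorem swap_lt_swap_iff {n : ℕ} {i j : Fin n} (hij : (j : ℕ) = i + 1) (a b : Fin n)
    (h : ¬ (a = i ∧ b = j)) (h' : ¬ (a = j ∧ b = i)) : swap i j a < swap i j b ↔ a < b := by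
  simp only [Fin.ext_iff] at h h'
  simp only [swap_apply_def, Fin.ext_iff]
  split_ifs <;> simp only [Fin.lt_def] <;> omega

theorem inversionCount_mul_swap {n : ℕ} {i j : Fin n} (hij : (j : ℕ) = i + 1)
    (w : Perm (Fin n)) (h : w i < w j) :
    inversionCount (w * swap i j) = inversionCount w + 1 := by
  have hlt : i < j := by rw [Fin.lt_def]; omega
  set e : (Fin n × Fin n) ≃ (Fin n × Fin n) := (swap i j).prodCongr (swap i j) with he
  -- Only the pair `(i, j)` changes its order under the transposition, so the inversions of `w`
  -- correspond under `e` to those of the product other than `(i, j)`.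
  have key : (Finset.univ.filter fun x : Fin n × Fin n =>
        x.1 < x.2 ∧ (w * swap i j) x.2 < (w * swap i j) x.1) =
      insert (i, j) ((Finset.univ.filter fun x : Fin n × Fin n =>
        x.1 < x.2 ∧ w x.2 < w x.1).map e.toEmbedding) := by
    ext ⟨a, b⟩
    have hs : e.symm (a, b) = (swap i j a, swap i j b) := by
      simp [he]
    rw [Finset.mem_insert, Finset.mem_map_equiv, hs, Finset.mem_filter, Finset.mem_filter]
    simp only [Finset.mem_univ, true_and, Perm.mul_apply, Prod.mk.injEq]
    by_cases h1 : a = i ∧ b = j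
    · obtain ⟨rfl, rfl⟩ := h1
      simp [hlt, h]
    by_cases h2 : a = j ∧ b = i
    · obtain ⟨rfl, rfl⟩ := h2
      simp [hlt.not_gt, h.not_gt, hlt.ne']
    rw [swap_lt_swap_iff hij a b h1 h2]
    simp [h1]
  rw [inversionCount, key, Finset.card_insert_of_notMem, Finset.card_map, inversionCount]
  rw [Finset.mem_map_equiv]
  simp [he, hlt.not_gt]

theorem inversionCount_inv {n : ℕ} (w : Perm (Fin n)) :
    inversionCount w⁻¹ = inversionCount w := by
  symm
  refine Finset.card_nbij' (fun x => (w x.2, w x.1)) (fun x => (w⁻¹ x.2, w⁻¹ x.1)) ?_ ?_ ?_ ?_ <;>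
    intro x hx <;> simp_all

theorem inversionCount_swap_mul {n : ℕ} {i j : Fin n} (hij : (j : ℕ) = i + 1)
    (w : Perm (Fin n)) (h : w⁻¹ i < w⁻¹ j) :
    inversionCount (swap i j * w) = inversionCount w + 1 := by
  rw [← inversionCount_inv, mul_inv_rev, swap_inv, inversionCount_mul_swap hij _ h,
    inversionCount_inv]

theorem inversionCount_mul_swap_of_gt {n : ℕ} {i j : Fin n} (hij : (j : ℕ) = i + 1)
    (w : Perm (Fin n)) (h : w j < w i) :
    inversionCount (w * swap i j) + 1 = inversionCount w := by
  rw [← inversionCount_mul_swap hij (w * swap i j) (by simpa using h), mul_assoc, swap_mul_self,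
    mul_one]

theorem inversionCount_swap_mul_of_gt {n : ℕ} {i j : Fin n} (hij : (j : ℕ) = i + 1)
    (w : Perm (Fin n)) (h : w⁻¹ j < w⁻¹ i) :
    inversionCount (swap i j * w) + 1 = inversionCount w := by
  rw [← inversionCount_inv, mul_inv_rev, swap_inv, inversionCount_mul_swap_of_gt hij _ h,
    inversionCount_inv]

theorem inversionCount_mul_swap_le {n : ℕ} {i j : Fin n} (hij : (j : ℕ) = i + 1)
    (w : Perm (Fin n)) : inversionCount (w * swap i j) ≤ inversionCount w + 1 := by
  have hne : i ≠ j := fun h => by rw [h] at hij; omega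
  rcases lt_or_gt_of_ne (w.injective.ne hne) with h | h
  · exact (inversionCount_mul_swap hij w h).le
  · have := inversionCount_mul_swap_of_gt hij w h
    omega

theorem inversionCount_le_mul_swap {n : ℕ} {i j : Fin n} (hij : (j : ℕ) = i + 1)
    (w : Perm (Fin n)) : inversionCount w ≤ inversionCount (w * swap i j) + 1 := by
  simpa [mul_assoc] using inversionCount_mul_swap_le hij (w * swap i j)

theorem inversionCount_swap_mul_le {n : ℕ} {i j : Fin n} (hij : (j : ℕ) = i + 1)
    (w : Perm (Fin n)) : inversionCount (swap i j * w) ≤ inversionCount w + 1 := by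
  rw [← inversionCount_inv, mul_inv_rev, swap_inv, ← inversionCount_inv w]
  exact inversionCount_mul_swap_le hij _

theorem inversionCount_one {n : ℕ} : inversionCount (1 : Perm (Fin n)) = 0 := by
  rw [inversionCount, Finset.card_eq_zero, Finset.filter_eq_empty_iff]
  rintro ⟨a, b⟩ - ⟨h1, h2⟩
  exact lt_asymm h1 h2

theorem inversionCount_list_prod_le {n : ℕ} (l : List (Perm (Fin n)))
    (h : ∀ s ∈ l, s ∈ adjacentTranspositions n) : inversionCount l.prod ≤ l.length := by
  induction l with
  | nil => simp [inversionCount_one]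
  | cons s l ih =>
    obtain ⟨i, j, hij, rfl⟩ := h s (by simp)
    have h1 := ih fun s hs => h s (by simp [hs])
    have h2 := inversionCount_swap_mul_le hij l.prod
    rw [List.prod_cons, List.length_cons]
    omega

theorem eq_one_of_forall_lt {n : ℕ} (w : Perm (Fin n))
    (h : ∀ i j : Fin n, (j : ℕ) = i + 1 → w i < w j) : w = 1 := by
  have hm : StrictMono w := by
    have : ∀ k : ℕ, ∀ i j : Fin n, (j : ℕ) = i + 1 + k → w i < w j := by
      intro k
      induction k with
      | zero => exact fun i j hij => h i j (by omega)
      | succ k ih =>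
        intro i j hij
        have hj := j.isLt
        exact (ih i ⟨i + 1 + k, by omega⟩ rfl).trans (h _ j (by simp; omega))
    intro i j hij
    rw [Fin.lt_def] at hij
    exact this (j - i - 1) i j (by omega)
  have := Subsingleton.elim (hm.orderIsoOfSurjective w w.surjective) (OrderIso.refl (Fin n))
  ext i
  exact congrArg Fin.val (DFunLike.congr_fun this i)

theorem exists_isWord_length_eq {n : ℕ} (w : Perm (Fin n)) :
    ∃ l : List (Perm (Fin n)), IsWord l w ∧ l.length = inversionCount w := by
  induction hk : inversionCount w generalizing w with
  | zero =>
    refine ⟨[], ⟨by simp, ?_⟩, by simp⟩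
    refine (eq_one_of_forall_lt w fun i j hij => ?_).symm
    by_contra hc
    have hne : j ≠ i := fun h => by rw [h] at hij; omega
    have := inversionCount_mul_swap_of_gt hij w (lt_of_le_of_ne (not_lt.1 hc) (w.injective.ne hne))
    omega
  | succ k ih =>
    have : ∃ i j : Fin n, (j : ℕ) = i + 1 ∧ w j < w i := by
      by_contra! hc
      have : w = 1 := eq_one_of_forall_lt w fun i j hij =>
        lt_of_le_of_ne (hc i j hij) (w.injective.ne fun h => by rw [h] at hij; omega)
      rw [this, inversionCount_one] at hk
      omega
    obtain ⟨i, j, hij, h⟩ := this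
    have hw := inversionCount_mul_swap_of_gt hij w h
    obtain ⟨l, ⟨hl, hp⟩, hlen⟩ := ih (w * swap i j) (by omega)
    refine ⟨l ++ [swap i j], ⟨fun s hs => ?_, by simp [hp, mul_assoc]⟩, by simp [hlen]⟩
    rcases List.mem_append.1 hs with hs | hs
    · exact hl s hs
    · exact ⟨i, j, hij, List.mem_singleton.1 hs⟩

/-- The Coxeter length of a permutation is its number of inversions. -/
theorem length_eq_inversionCount {n : ℕ} (w : Perm (Fin n)) : length w = inversionCount w := by
  refine le_antisymm (Nat.sInf_le (exists_isWord_length_eq w)) ?_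
  obtain ⟨l, ⟨hl, hp⟩, hlen⟩ := Nat.sInf_mem (s := {k : ℕ | ∃ l : List (Perm (Fin n)),
    IsWord l w ∧ l.length = k}) ⟨_, exists_isWord_length_eq w⟩
  rw [length, ← hlen, ← hp]
  exact inversionCount_list_prod_le l hl

/-! ### Length under conjugation by an adjacent transposition -/

theorem length_le_length_conj_swap {n : ℕ} {i j : Fin n} (hij : (j : ℕ) = i + 1)
    (w : Perm (Fin n)) (h : w⁻¹ i < w⁻¹ j) :
    length w ≤ length (swap i j * w * swap i j) := by
  have h1 := inversionCount_swap_mul hij w h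
  have h2 := inversionCount_le_mul_swap hij (swap i j * w)
  simp only [length_eq_inversionCount]
  omega

/-- Each of the two multiplications removes an inversion, unless `w` exchanges `i` and `j`; in that
case the transposition commutes with `w`. -/
theorem conj_swap_eq_or_length_lt {n : ℕ} {i j : Fin n} (hij : (j : ℕ) = i + 1)
    (w : Perm (Fin n)) (h : w j < w i) (h' : w⁻¹ j < w⁻¹ i) :
    swap i j * w * swap i j = w ∨ length (swap i j * w * swap i j) < length w := by
  by_cases hc : w i = j ∧ w j = i
  · left
    rw [mul_assoc, mul_swap_eq_swap_mul, hc.1, hc.2, swap_comm j i, swap_mul_self_mul]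
  · right
    have hc' : ¬ (w⁻¹ j = i ∧ w⁻¹ i = j) := by
      rintro ⟨h1, h2⟩
      refine hc ⟨?_, ?_⟩
      · rw [← h1]; simp
      · rw [← h2]; simp
    have hne : ¬ (w⁻¹ j = j ∧ w⁻¹ i = i) := by
      rintro ⟨h1, h2⟩
      rw [h1, h2, Fin.lt_def] at h'
      omega
    have h1 := inversionCount_mul_swap_of_gt hij w h
    have h2 := inversionCount_swap_mul_of_gt hij (w * swap i j) (by
      rw [mul_inv_rev, swap_inv, Perm.mul_apply, Perm.mul_apply,
        swap_lt_swap_iff hij _ _ hc' hne]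
      exact h')
    simp only [length_eq_inversionCount]
    rw [mul_assoc]
    omega

/-! ### Stair positions and the stair form in these coordinates -/

/-- Each position takes an end of the interval of entries still unused: the lower end at even
positions, the upper end at odd ones. All later comparisons of entries reduce to this parity rule.
-/
theorem stairEntry_lt_iff {n : ℕ} {p q : Fin n} (h : p < q) :
    stairEntry p < stairEntry q ↔ Even (p : ℕ) := by
  have hp := p.isLt
  have hq := q.isLt
  rw [Fin.lt_def] at h
  simp only [stairEntry]
  split_ifs with h1 h2 h2 <;> simp only [Fin.lt_def, Nat.even_iff] at * <;> omega

theorem stairEntry_injective {n : ℕ} : Function.Injective (stairEntry (n := n)) := by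
  intro p q h
  have hp := p.isLt
  have hq := q.isLt
  simp only [stairEntry] at h
  ext
  split_ifs at h <;> simp only [Nat.even_iff, Fin.mk.injEq] at * <;> omega

theorem stairEntry_surjective {n : ℕ} : Function.Surjective (stairEntry (n := n)) :=
  Finite.surjective_of_injective stairEntry_injective

/-- The successor map on positions that runs cyclically through consecutive blocks of sizes given
by a list. -/
def blockSucc : List ℕ → ℕ → ℕ
  | [], p => p
  | a :: l, p => if p < a then (if p + 1 = a then 0 else p + 1) else a + blockSucc l (p - a)

theorem blockSucc_lt {l : List ℕ} {p : ℕ} (h : p < l.sum) : blockSucc l p < l.sum := by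
  induction l generalizing p with
  | nil => simp at h
  | cons a l ih =>
    rw [List.sum_cons] at *
    rw [blockSucc]
    split_ifs with h1 h2
    · omega
    · omega
    · have := ih (p := p - a) (by omega)
      omega

theorem exists_blockSucc_eq {l : List ℕ} {q : ℕ} (h : q < l.sum) :
    ∃ p < l.sum, blockSucc l p = q := by
  induction l generalizing q with
  | nil => simp at h
  | cons a l ih =>
    rw [List.sum_cons] at *
    by_cases hq : q < a
    · by_cases hq0 : q = 0
      · exact ⟨a - 1, by omega, by rw [blockSucc, if_pos (by omega), if_pos (by omega), hq0]⟩
      · exact ⟨q - 1, by omega, by rw [blockSucc, if_pos (by omega), if_neg (by omega)]; omega⟩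
    · obtain ⟨p, hp, he⟩ := ih (q := q - a) (by omega)
      exact ⟨a + p, by omega, by
        rw [blockSucc, if_neg (by omega), Nat.add_sub_cancel_left, he]; omega⟩

theorem blockSucc_append_of_lt {l l' : List ℕ} {p : ℕ} (h : p < l.sum) :
    blockSucc (l ++ l') p = blockSucc l p := by
  induction l generalizing p with
  | nil => simp at h
  | cons a l ih =>
    rw [List.sum_cons] at h
    rw [List.cons_append, blockSucc, blockSucc]
    split_ifs with h1 h2
    · rfl
    · rfl
    · rw [ih (by omega)]

theorem blockSucc_append_of_le {l l' : List ℕ} {p : ℕ} (h : l.sum ≤ p) :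
    blockSucc (l ++ l') p = l.sum + blockSucc l' (p - l.sum) := by
  induction l generalizing p with
  | nil => simp
  | cons a l ih =>
    rw [List.sum_cons] at *
    rw [List.cons_append, blockSucc, if_neg (by omega), ih (by omega), add_assoc, Nat.sub_sub]

theorem blockSucc_take_sum_add (l : List ℕ) (i j : ℕ) (hi : i < l.length) (hj : j < l[i]) :
    blockSucc l ((l.take i).sum + j) = (l.take i).sum + (if j + 1 = l[i] then 0 else j + 1) := by
  have hl : l = l.take i ++ l[i] :: l.drop (i + 1) := by
    rw [← List.drop_eq_getElem_cons hi, List.take_append_drop]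
  have h := blockSucc_append_of_le (l := l.take i) (l' := l[i] :: l.drop (i + 1))
    (p := (l.take i).sum + j) (by omega)
  rw [← hl, Nat.add_sub_cancel_left, blockSucc, if_pos hj] at h
  exact h

theorem list_ofFn_prod_apply {X : Type*} {m : ℕ} (g : Fin m → Perm X) (i : Fin m) (x : X)
    (h : ∀ k, k ≠ i → g k x = x) (h' : ∀ k, k ≠ i → g k (g i x) = g i x) :
    (List.ofFn g).prod x = g i x := by
  induction m with
  | zero => exact i.elim0
  | succ m ih =>
    rw [List.ofFn_succ, List.prod_cons, Perm.mul_apply]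
    induction i using Fin.cases with
    | zero =>
      congr 1
      have : ∀ s ∈ List.ofFn fun k : Fin m => g k.succ, s x = x := by
        intro s hs
        obtain ⟨k, rfl⟩ := (List.mem_ofFn' _ _).1 hs
        exact h _ (Fin.succ_ne_zero k)
      revert this
      generalize (List.ofFn fun k : Fin m => g k.succ) = t
      intro ht
      induction t with
      | nil => rfl
      | cons s t iht =>
        rw [List.prod_cons, Perm.mul_apply, iht fun s hs => ht s (by simp [hs]), ht s (by simp)]
    | succ i =>
      rw [ih (fun k => g k.succ) i (fun k hk => h _ (by simpa using hk))
        (fun k hk => h' _ (by simpa using hk))]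
      exact h' 0 (Fin.succ_ne_zero i).symm

theorem stairCycle_apply {n : ℕ} (α : Composition n) (i : Fin α.length)
    (j : Fin (α.blocksFun i)) :
    stairCycle α i (stairEntry (α.embedding i j)) = stairEntry (α.embedding i
      ⟨(j + 1) % α.blocksFun i, Nat.mod_lt _ (Nat.zero_lt_of_lt j.isLt)⟩) := by
  have hnd : (List.ofFn fun j : Fin (α.blocksFun i) => stairEntry (α.embedding i j)).Nodup :=
    List.nodup_ofFn.2 (stairEntry_injective.comp (α.embedding i).injective)
  have := List.formPerm_apply_getElem _ hnd j (by simp)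
  simpa [stairCycle] using this

theorem stairCycle_apply_of_ne {n : ℕ} (α : Composition n) (i k : Fin α.length) (hk : k ≠ i)
    (j : Fin (α.blocksFun i)) :
    stairCycle α k (stairEntry (α.embedding i j)) = stairEntry (α.embedding i j) := by
  refine List.formPerm_apply_of_notMem ?_
  rw [List.mem_ofFn']
  rintro ⟨j', h⟩
  exact Set.disjoint_left.1 (α.disjoint_range hk) ⟨j', rfl⟩
    ⟨j, (stairEntry_injective h).symm⟩

/-- In the coordinates given by `stairEntry`, the element in stair form is `blockSucc`. -/
theorem stairForm_apply {n : ℕ} (α : Composition n) {p q : Fin n}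
    (h : (q : ℕ) = blockSucc α.blocks p) : stairForm α (stairEntry p) = stairEntry q := by
  obtain ⟨⟨i, j⟩, rfl⟩ := α.blocksFinEquiv.surjective p
  change stairForm α (stairEntry (α.embedding i j)) = _
  rw [stairForm, list_ofFn_prod_apply _ i _ (fun k hk => stairCycle_apply_of_ne α i k hk j),
    stairCycle_apply]
  · congr 1
    ext
    have hj : (j : ℕ) < α.blocks[(i : ℕ)] := j.isLt
    have he : ((α.blocksFinEquiv ⟨i, j⟩ : Fin n) : ℕ) = (α.blocks.take i).sum + j := rfl
    rw [h, he, blockSucc_take_sum_add _ _ _ i.isLt hj, Composition.coe_embedding]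
    change (α.blocks.take i).sum + ((j : ℕ) + 1) % α.blocks[(i : ℕ)] = _
    split_ifs with hc
    · rw [hc, Nat.mod_self]
    · rw [Nat.mod_eq_of_lt (by omega)]
  · intro k hk
    rw [stairCycle_apply]
    exact stairCycle_apply_of_ne α i k hk _

/-! ### Every permutation is reached from a stair form -/

theorem shift_conj_swap {n : ℕ} {i j : Fin n} (hij : (j : ℕ) = i + 1) (w : Perm (Fin n))
    (h : w⁻¹ i < w⁻¹ j) : Shift (swap i j * w * swap i j) w :=
  Relation.ReflTransGen.single ⟨swap i j, ⟨i, j, hij, rfl⟩,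
    by simp [mul_assoc], length_le_length_conj_swap hij w h⟩

/-- An entry that `w` reaches from the stair position `d - 1` can be brought to the stair
position `d` by cyclic shifts that do not decrease the length. -/
theorem exists_shift_conj {n : ℕ} (p d : Fin n) (hpd : (d : ℕ) = p + 1) (m : ℕ) :
    ∀ (w : Perm (Fin n)), (∀ r < p, ∃ t < d, w (stairEntry r) = stairEntry t) →
    (∀ t < d, w (stairEntry p) ≠ stairEntry t) →
    ((w (stairEntry p) : ℕ) - (stairEntry d : ℕ) + (stairEntry d - w (stairEntry p)) = m) →
    ∃ τ : Perm (Fin n), (∀ t < d, τ (stairEntry t) = stairEntry t) ∧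
      τ (w (stairEntry p)) = stairEntry d ∧ Shift (τ * w * τ⁻¹) w := by
  have hpd' : p < d := by rw [Fin.lt_def]; omega
  -- The sum of the two truncated differences is the distance from `w (stairEntry p)` to `stairEntry
  -- d`; each conjugation shortens it by one.
  induction m with
  | zero =>
    intro w _ _ hm
    refine ⟨1, fun _ _ => rfl, Fin.ext ?_, ?_⟩
    · rw [Perm.one_apply]; omega
    · rw [one_mul, inv_one, mul_one]; exact Relation.ReflTransGen.refl
  | succ m ih =>
    intro w h1 h2 hm
    -- the neighbour `z` of `y` on the way to `stairEntry d`
    obtain ⟨y, hy⟩ : ∃ y, y = w (stairEntry p) := ⟨_, rfl⟩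
    rw [← hy] at h2 hm
    have hstep : ∀ z : Fin n, (∀ t < d, z ≠ stairEntry t) → z ≠ y →
        Shift (swap z y * w * swap z y) w →
        ((z : ℕ) - (stairEntry d : ℕ) + (stairEntry d - z) = m) →
        ∃ τ : Perm (Fin n), (∀ t < d, τ (stairEntry t) = stairEntry t) ∧
          τ y = stairEntry d ∧ Shift (τ * w * τ⁻¹) w := by
      intro z hz hzy hs hzm
      have hfix : ∀ t < d, swap z y (stairEntry t) = stairEntry t := fun t ht =>
        swap_apply_of_ne_of_ne (hz t ht).symm (h2 t ht).symm
      have hp : (swap z y * w * swap z y) (stairEntry p) = z := by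
        rw [Perm.mul_apply, hfix p hpd', Perm.mul_apply, ← hy, swap_apply_right]
      obtain ⟨τ, ht1, ht2, ht3⟩ := ih (swap z y * w * swap z y) (by
          intro r hr
          obtain ⟨t, ht, he⟩ := h1 r hr
          refine ⟨t, ht, ?_⟩
          rw [Perm.mul_apply, hfix r (hr.trans hpd'), Perm.mul_apply, he, hfix t ht])
        (by rw [hp]; exact hz) (by rw [hp]; exact hzm)
      refine ⟨τ * swap z y, fun t ht => ?_, ?_, ?_⟩
      · rw [Perm.mul_apply, hfix t ht, ht1 t ht]
      · rw [Perm.mul_apply, swap_apply_right, ← hp, ht2]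
      · have h3 : τ * swap z y * w * (τ * swap z y)⁻¹ =
            τ * (swap z y * w * swap z y) * τ⁻¹ := by simp [mul_assoc]
        rw [h3]
        exact Relation.ReflTransGen.trans ht3 hs
    -- Positions before `p` are sent to positions before `d`, and `p` itself to `y`; so the preimage
    -- of any other outer entry lies beyond `p`.
    have hpre : ∀ z : Fin n, (∀ t < d, z ≠ stairEntry t) → z ≠ y →
        ∃ r, p < r ∧ w⁻¹ z = stairEntry r := by
      intro z hz hzy
      obtain ⟨r, hr⟩ := stairEntry_surjective (w⁻¹ z)
      have hr' : w (stairEntry r) = z := by rw [hr]; simp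
      refine ⟨r, ?_, hr.symm⟩
      by_contra hc
      rcases lt_or_eq_of_le (not_lt.1 hc) with hlt | rfl
      · obtain ⟨t, ht, he⟩ := h1 r hlt
        exact hz t ht (by rw [← hr', he])
      · exact hzy (by rw [hy, hr'])
    have hyp : w⁻¹ y = stairEntry p := by rw [hy]; simp
    obtain ⟨q, hq⟩ := stairEntry_surjective y
    have hdq : d < q := by
      rcases lt_trichotomy d q with h | rfl | h
      · exact h
      · rw [hq] at hm; omega
      · exact absurd hq.symm (h2 q h)
    -- The entries outside the first `d` positions form an interval with `stairEntry d` at one end,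
    -- so the neighbour `z` of `y` towards it is again outside. As `p` and `d` have opposite
    -- parities, `stairEntry p` lies on the other side of all later entries, which gives `w⁻¹ z` and
    -- `w⁻¹ y` the order that prevents the conjugate from being shorter.
    by_cases hd : Even (d : ℕ)
    · have hlt : stairEntry d < y := hq ▸ (stairEntry_lt_iff hdq).2 hd
      have hpo : ¬ Even (p : ℕ) := by rw [Nat.even_iff] at *; omega
      rw [Fin.lt_def] at hlt
      have hyn := y.isLt
      obtain ⟨z, hz⟩ : ∃ z : Fin n, (z : ℕ) = y - 1 := ⟨⟨y - 1, by omega⟩, rfl⟩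
      have hzt : ∀ t < d, z ≠ stairEntry t := by
        intro t ht he
        have h3 := stairEntry_lt_iff ht
        have h4 := stairEntry_lt_iff (ht.trans hdq)
        have h5 : y ≠ stairEntry t := h2 t ht
        rw [hq] at h4
        have h6 := h3.trans h4.symm
        rw [← he, Fin.lt_def, Fin.lt_def] at h6
        rw [← he, Ne, Fin.ext_iff] at h5
        omega
      have hzy : z ≠ y := by rw [Ne, Fin.ext_iff]; omega
      refine hy ▸ hstep z hzt hzy (shift_conj_swap (by omega) w ?_) (by omega)
      obtain ⟨r, hr, he⟩ := hpre z hzt hzy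
      rw [hyp, he]
      refine lt_of_le_of_ne (not_lt.1 fun hc => hpo ((stairEntry_lt_iff hr).1 hc)) fun hc => ?_
      exact hr.ne' (stairEntry_injective hc)
    · have hlt : y < stairEntry d := by
        refine lt_of_le_of_ne (not_lt.1 fun hc => hd ((stairEntry_lt_iff hdq).1 (hq ▸ hc))) ?_
        exact fun hc => hdq.ne' (stairEntry_injective (hq.trans hc))
      have hpe : Even (p : ℕ) := by rw [Nat.even_iff] at *; omega
      rw [Fin.lt_def] at hlt
      have hyn := (stairEntry d).isLt
      obtain ⟨z, hz⟩ : ∃ z : Fin n, (z : ℕ) = y + 1 := ⟨⟨y + 1, by omega⟩, rfl⟩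
      have hzt : ∀ t < d, z ≠ stairEntry t := by
        intro t ht he
        have h3 := stairEntry_lt_iff ht
        have h4 := stairEntry_lt_iff (ht.trans hdq)
        have h5 : stairEntry d ≠ stairEntry t := fun h => ht.ne' (stairEntry_injective h)
        rw [hq] at h4
        have h6 := h3.trans h4.symm
        rw [← he, Fin.lt_def, Fin.lt_def] at h6
        rw [← he, Ne, Fin.ext_iff] at h5
        omega
      have hzy : z ≠ y := by rw [Ne, Fin.ext_iff]; omega
      refine hy ▸ hstep z hzt hzy ?_ (by omega)
      rw [swap_comm]
      refine shift_conj_swap (by omega) w ?_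
      obtain ⟨r, hr, he⟩ := hpre z hzt hzy
      rw [hyp, he]
      exact (stairEntry_lt_iff hr).2 hpe

/-- Here `l` lists the blocks already closed and the positions from `l.sum` to `d - 1` form a block
under construction. A round opens a block, closes it when the cycle returns to its start, or extends
it by `exists_shift_conj`. The measure counts unplaced positions twice and adds one for an open
block, so it drops in all three cases. -/
theorem exists_shift_stairForm_aux {n : ℕ} (m : ℕ) :
    ∀ (w : Perm (Fin n)) (l : List ℕ) (d : ℕ), (∀ a ∈ l, 0 < a) → l.sum ≤ d → d ≤ n →
    2 * (n - d) + (if l.sum < d then 1 else 0) < m →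
    (∀ p q : Fin n, (p : ℕ) < l.sum → (q : ℕ) = blockSucc l p →
      w (stairEntry p) = stairEntry q) →
    (∀ p q : Fin n, l.sum ≤ p → (q : ℕ) = p + 1 → (q : ℕ) < d →
      w (stairEntry p) = stairEntry q) →
    ∃ β : Composition n, Shift (stairForm β) w := by
  induction m with
  | zero => intros; omega
  | succ m ih =>
    intro w l d hpos hld hdn hm h1 h2
    rcases hld.eq_or_lt with hld' | hlt
    · rcases hdn.eq_or_lt with hdn' | hdn'
      · refine ⟨⟨l, fun {i} hi => hpos i hi, hld'.trans hdn'⟩, ?_⟩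
        have : stairForm ⟨l, fun {i} hi => hpos i hi, hld'.trans hdn'⟩ = w := by
          ext v
          obtain ⟨p, rfl⟩ := stairEntry_surjective v
          have hp : (p : ℕ) < l.sum := by omega
          have hq := blockSucc_lt hp
          rw [stairForm_apply _ (q := ⟨blockSucc l p, by omega⟩) rfl,
            h1 p ⟨blockSucc l p, by omega⟩ hp rfl]
        rw [this]
        exact Relation.ReflTransGen.refl
      · refine ih w l (d + 1) hpos (by omega) hdn' ?_ h1 fun p q hp hq hqd => ?_
        · rw [if_pos (by omega)]
          rw [if_neg (by omega)] at hm
          omega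
        · omega
    · rw [if_pos hlt] at hm
      obtain ⟨p, hp⟩ : ∃ p : Fin n, (p : ℕ) = d - 1 := ⟨⟨d - 1, by omega⟩, rfl⟩
      obtain ⟨y, hy⟩ := stairEntry_surjective (w (stairEntry p))
      have hye : l.sum ≤ y := by
        by_contra hc
        obtain ⟨t, ht, he⟩ := exists_blockSucc_eq (not_le.1 hc)
        have := h1 ⟨t, by omega⟩ y ht he.symm
        have := Fin.ext_iff.1 (stairEntry_injective (w.injective (this.trans hy)))
        simp only at this
        omega
      have hyd : (y : ℕ) = l.sum ∨ d ≤ y := by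
        by_contra! hc
        have := h2 ⟨y - 1, by omega⟩ y (by simp; omega) (by simp; omega) hc.2
        have := Fin.ext_iff.1 (stairEntry_injective (w.injective (this.trans hy)))
        simp only at this
        omega
      rcases hyd with hyd | hyd
      · have hsum : (l ++ [d - l.sum]).sum = d := by simp; omega
        refine ih w (l ++ [d - l.sum]) d ?_ hsum.le hdn ?_ ?_ ?_
        · intro a ha
          rcases List.mem_append.1 ha with ha | ha
          · exact hpos a ha
          · rw [List.mem_singleton.1 ha]; omega
        · rw [if_neg (by omega)]; omega
        · intro r q hr hq
          rw [hsum] at hr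
          rcases lt_or_ge (r : ℕ) l.sum with hrl | hrl
          · rw [blockSucc_append_of_lt hrl] at hq
            exact h1 r q hrl hq
          · rw [blockSucc_append_of_le hrl, blockSucc, if_pos (by omega)] at hq
            split_ifs at hq with hc
            · have hrp : r = p := Fin.ext (by omega)
              have hqy : q = y := Fin.ext (by omega)
              rw [hrp, hqy, hy]
            · exact h2 r q hrl (by omega) (by omega)
        · intro r q hr hq hqd
          omega
      · obtain ⟨c, hc⟩ : ∃ c : Fin n, (c : ℕ) = d := ⟨⟨d, by omega⟩, rfl⟩
        obtain ⟨τ, ht1, ht2, ht3⟩ := exists_shift_conj p c (by omega) _ w (by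
            intro r hr
            rw [Fin.lt_def] at hr
            rcases lt_or_ge (r : ℕ) l.sum with hrl | hrl
            · have := blockSucc_lt hrl
              exact ⟨⟨blockSucc l r, by omega⟩, by rw [Fin.lt_def]; simp; omega, h1 r _ hrl rfl⟩
            · exact ⟨⟨r + 1, by omega⟩, by rw [Fin.lt_def]; simp; omega,
                h2 r _ hrl rfl (by simp; omega)⟩)
          (by
            intro t ht he
            rw [← hy] at he
            rw [stairEntry_injective he] at hyd
            rw [Fin.lt_def] at ht
            omega) rfl
        have hτ : ∀ t : Fin n, (t : ℕ) < d → τ⁻¹ (stairEntry t) = stairEntry t := fun t ht => by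
          rw [Perm.inv_eq_iff_eq, ht1 t (by rw [Fin.lt_def]; omega)]
        obtain ⟨β, hβ⟩ := ih (τ * w * τ⁻¹) l (d + 1) hpos (by omega) (by omega)
          (by rw [if_pos (by omega)]; omega)
          (by
            intro r q hr hq
            have := blockSucc_lt hr
            rw [Perm.mul_apply, Perm.mul_apply, hτ r (by omega), h1 r q hr hq,
              ht1 q (by rw [Fin.lt_def]; omega)])
          (by
            intro r q hr hq hqd
            rw [Perm.mul_apply, Perm.mul_apply, hτ r (by omega)]
            rcases (show (q : ℕ) ≤ d by omega).lt_or_eq with h | h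
            · rw [h2 r q hr hq h, ht1 q (by rw [Fin.lt_def]; omega)]
            · have hrp : r = p := Fin.ext (by omega)
              have hqc : q = c := Fin.ext (by omega)
              rw [hrp, hqc, ht2])
        exact ⟨β, hβ.trans ht3⟩

/-- Every permutation is obtained by cyclic shifts from an element in stair form. -/
theorem exists_shift_stairForm {n : ℕ} (w : Perm (Fin n)) :
    ∃ β : Composition n, Shift (stairForm β) w :=
  exists_shift_stairForm_aux _ w [] 0 (by simp) le_rfl (Nat.zero_le n) (Nat.lt_succ_self _)
    (by simp) (by intros; omega)

/-! ### The length of a stair form and its maximal arrangements -/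

open Classical in
theorem card_lt_pairs_comp {n : ℕ} (x : Perm (Fin n)) (S : Fin n → Fin n → Prop)
    (hS : ∀ i j, S i j ↔ S j i) :
    (Finset.univ.filter fun z : Fin n × Fin n => z.1 < z.2 ∧ S (x z.1) (x z.2)).card =
      (Finset.univ.filter fun z : Fin n × Fin n => z.1 < z.2 ∧ S z.1 z.2).card := by
  have two : ∀ T : Fin n → Fin n → Prop, (∀ i j, T i j ↔ T j i) →
      (Finset.univ.filter fun z : Fin n × Fin n => z.1 ≠ z.2 ∧ T z.1 z.2).card =
        2 * (Finset.univ.filter fun z : Fin n × Fin n => z.1 < z.2 ∧ T z.1 z.2).card := by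
    intro T hT
    have h1 : (Finset.univ.filter fun z : Fin n × Fin n => z.1 ≠ z.2 ∧ T z.1 z.2) =
        (Finset.univ.filter fun z : Fin n × Fin n => z.1 < z.2 ∧ T z.1 z.2) ∪
        (Finset.univ.filter fun z : Fin n × Fin n => z.2 < z.1 ∧ T z.1 z.2) := by
      ext z
      simp only [Finset.mem_filter, Finset.mem_univ, true_and, Finset.mem_union, ne_iff_lt_or_gt]
      tauto
    have h2 : (Finset.univ.filter fun z : Fin n × Fin n => z.2 < z.1 ∧ T z.1 z.2).card =
        (Finset.univ.filter fun z : Fin n × Fin n => z.1 < z.2 ∧ T z.1 z.2).card := by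
      refine Finset.card_nbij' Prod.swap Prod.swap ?_ ?_ ?_ ?_ <;> intro z hz
      · simpa [hT z.2 z.1] using hz
      · simpa [hT z.2 z.1] using hz
      · simp
      · simp
    rw [h1, Finset.card_union_of_disjoint, h2, two_mul]
    rw [Finset.disjoint_filter]
    rintro z - ⟨h, -⟩ ⟨h', -⟩
    exact lt_asymm h h'
  have h3 : (Finset.univ.filter fun z : Fin n × Fin n => z.1 ≠ z.2 ∧ S (x z.1) (x z.2)).card =
      (Finset.univ.filter fun z : Fin n × Fin n => z.1 ≠ z.2 ∧ S z.1 z.2).card := by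
    refine Finset.card_bij' (fun z _ => (x z.1, x z.2)) (fun z _ => (x.symm z.1, x.symm z.2))
      ?_ ?_ ?_ ?_ <;> intro z hz <;> simp_all
  rw [two S hS, two (fun i j => S (x i) (x j)) fun i j => hS _ _] at h3
  omega

/-- The order of the entries at two distinct stair positions. -/
def PosLt (p q : ℕ) : Prop := if p < q then Even p else ¬ Even q

theorem stairEntry_lt_iff_posLt {n : ℕ} {p q : Fin n} (h : p ≠ q) :
    stairEntry p < stairEntry q ↔ PosLt p q := by
  rcases lt_or_gt_of_ne h with h | h
  · rw [stairEntry_lt_iff h, PosLt, if_pos (Fin.lt_def.1 h)]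
  · rw [PosLt, if_neg (by rw [Fin.lt_def] at h; omega), ← stairEntry_lt_iff h, not_lt]
    exact ⟨le_of_lt, fun hc => lt_of_le_of_ne hc fun he => h.ne' (stairEntry_injective he)⟩

theorem posLt_add (a p q : ℕ) : PosLt (a + p) (a + q) ↔ (PosLt p q ↔ Even a) := by
  simp only [PosLt, add_lt_add_iff_left, Nat.even_add]
  split_ifs <;> tauto

/-- The pairs of stair positions whose order is reversed by `blockSucc l`. -/
def Reverses (l : List ℕ) (p q : ℕ) : Prop :=
  ¬ (PosLt p q ↔ PosLt (blockSucc l p) (blockSucc l q))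

open Classical in
/-- The number of pairs of stair positions whose order is reversed by `blockSucc l`. -/
noncomputable def reversalCount (l : List ℕ) : ℕ :=
  ∑ q ∈ Finset.range l.sum, ∑ p ∈ Finset.range q, if Reverses l p q then 1 else 0

/-- Being reversed by `w` is a symmetric property of a pair of entries, so the unordered pairs may
be counted in stair positions instead. -/
theorem inversionCount_stairForm {n : ℕ} (α : Composition n) :
    inversionCount (stairForm α) = reversalCount α.blocks := by
  classical
  set w := stairForm α with hw
  have hS : ∀ i j : Fin n, (i ≠ j ∧ ¬ (i < j ↔ w i < w j)) ↔ (j ≠ i ∧ ¬ (j < i ↔ w j < w i)) := by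
    intro i j
    rw [ne_comm]
    refine and_congr_right fun h => not_congr ?_
    have h1 : i < j ↔ ¬ j < i := by
      rw [not_lt]; exact ⟨le_of_lt, fun hc => lt_of_le_of_ne hc h.symm⟩
    have h2 : w i < w j ↔ ¬ w j < w i := by
      rw [not_lt]
      exact ⟨le_of_lt, fun hc => lt_of_le_of_ne hc (w.injective.ne h.symm)⟩
    rw [h1, h2, not_iff_not]
  have key := card_lt_pairs_comp
    (Equiv.ofBijective stairEntry (Finite.injective_iff_bijective.1 stairEntry_injective)) _ hS
  have e1 : inversionCount w = (Finset.univ.filter fun z : Fin n × Fin n =>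
      z.1 < z.2 ∧ (z.1 ≠ z.2 ∧ ¬ (z.1 < z.2 ↔ w z.1 < w z.2))).card := by
    rw [inversionCount]
    congr 1
    ext z
    simp only [Finset.mem_filter, Finset.mem_univ, true_and]
    refine and_congr_right fun h => ?_
    simp only [h, h.ne, ne_eq, not_false_eq_true, true_and, true_iff, not_lt]
    exact ⟨le_of_lt, fun hc => lt_of_le_of_ne hc (w.injective.ne h.ne')⟩
  replace key := e1.trans (Eq.trans (by congr!) key.symm)
  rw [key, Finset.card_filter, Fintype.sum_prod_type_right, reversalCount, α.blocks_sum,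
    ← Fin.sum_univ_eq_sum_range
      (fun q => ∑ p ∈ Finset.range q, if Reverses α.blocks p q then 1 else 0)]
  refine Finset.sum_congr rfl fun q _ => ?_
  have e2 : ∑ p ∈ Finset.range q, (if Reverses α.blocks p q then 1 else 0) =
      ∑ p ∈ Finset.range n, if p < q ∧ Reverses α.blocks p q then 1 else 0 := by
    rw [← Finset.sum_filter, ← Finset.sum_filter]
    refine Finset.sum_congr ?_ fun _ _ => rfl
    ext p
    have := q.isLt
    simp only [Finset.mem_filter, Finset.mem_range]
    constructor
    · exact fun h => ⟨by omega, h⟩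
    · exact fun h => h.2
  rw [e2, ← Fin.sum_univ_eq_sum_range
    (fun p => if p < (q : ℕ) ∧ Reverses α.blocks p q then 1 else 0)]
  refine Finset.sum_congr rfl fun p _ => ?_
  have hb : ∀ p : Fin n, blockSucc α.blocks p < n := fun p => by
    have := blockSucc_lt (l := α.blocks) (p := p) (by rw [α.blocks_sum]; exact p.isLt)
    rwa [α.blocks_sum] at this
  congr 1
  rw [← Fin.lt_def]
  refine propext (and_congr_right fun h => ?_)
  have hpq : stairEntry p ≠ stairEntry q := fun he => h.ne (stairEntry_injective he)
  have hwne := w.injective.ne hpq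
  have hp := stairForm_apply α (p := p) (q := ⟨_, hb p⟩) rfl
  have hq := stairForm_apply α (p := q) (q := ⟨_, hb q⟩) rfl
  change stairEntry p ≠ stairEntry q ∧
    ¬ (stairEntry p < stairEntry q ↔ w (stairEntry p) < w (stairEntry q)) ↔ _
  rw [← hw] at hp hq
  rw [hp, hq] at hwne ⊢
  rw [Reverses, stairEntry_lt_iff_posLt h.ne, stairEntry_lt_iff_posLt fun he => hwne (by rw [he])]
  exact and_iff_right hpq

theorem blockSucc_cons_of_lt {a : ℕ} {l : List ℕ} {p : ℕ} (h : p < a) :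
    blockSucc (a :: l) p = if p + 1 = a then 0 else p + 1 := by
  rw [blockSucc, if_pos h]

theorem blockSucc_cons_add {a : ℕ} {l : List ℕ} {p : ℕ} :
    blockSucc (a :: l) (a + p) = a + blockSucc l p := by
  rw [blockSucc, if_neg (by omega), Nat.add_sub_cancel_left]

theorem reverses_cons_add_add {a : ℕ} {l : List ℕ} {p q : ℕ} :
    Reverses (a :: l) (a + p) (a + q) ↔ Reverses l p q := by
  rw [Reverses, Reverses, blockSucc_cons_add, blockSucc_cons_add, posLt_add, posLt_add]
  tauto

theorem reverses_cons_add {a : ℕ} {l : List ℕ} {p q : ℕ} (h : p < a) :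
    Reverses (a :: l) p (a + q) ↔ (p + 1 = a → Even a) := by
  have h1 : blockSucc (a :: l) p < a + blockSucc l q := by
    rw [blockSucc_cons_of_lt h]; split_ifs <;> omega
  rw [Reverses, blockSucc_cons_add, PosLt, PosLt, if_pos h1, if_pos (by omega),
    blockSucc_cons_of_lt h]
  split_ifs with hc
  · rw [← hc]; simp [Nat.even_add_one]
  · simp only [Nat.even_add_one, hc, false_imp_iff, iff_true]; tauto

/-- Against any position of a later block, the parity of the position in the first block decides the
order. One step inside that block flips the parity; the return from `a - 1` to `0` flips it only for
even `a`. Hence `2 * (a / 2)` reversals for each later position. -/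
theorem reversalCount_cons (a : ℕ) (l : List ℕ) :
    reversalCount (a :: l) = reversalCount [a] + 2 * (a / 2) * l.sum + reversalCount l := by
  classical
  have hcross : ∀ q, ∑ p ∈ Finset.range a, (if Reverses (a :: l) p (a + q) then 1 else 0) =
      2 * (a / 2) := by
    intro q
    have : ∑ p ∈ Finset.range a, (if Reverses (a :: l) p (a + q) then 1 else 0) =
        ∑ p ∈ Finset.range a, if p + 1 = a → Even a then 1 else 0 :=
      Finset.sum_congr rfl fun p hp => by
        simp only [reverses_cons_add (Finset.mem_range.1 hp)]
    rw [this]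
    cases a with
    | zero => simp
    | succ a =>
      rw [Finset.sum_range_succ, Finset.sum_congr rfl (g := fun _ => 1)]
      · by_cases h : Even (a + 1)
        · simp [h]; rw [Nat.even_iff] at h; omega
        · simp [h]; rw [Nat.even_iff] at h; omega
      · intro p hp
        rw [Finset.mem_range] at hp
        rw [if_pos fun h => by omega]
  rw [reversalCount, List.sum_cons, Finset.sum_range_add]
  have h1 : ∑ q ∈ Finset.range a, ∑ p ∈ Finset.range q, (if Reverses (a :: l) p q then 1 else 0) =
      reversalCount [a] := by
    rw [reversalCount, List.sum_singleton]
    refine Finset.sum_congr rfl fun q hq => Finset.sum_congr rfl fun p hp => ?_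
    rw [Finset.mem_range] at hp hq
    simp only [Reverses, blockSucc_cons_of_lt hq, blockSucc_cons_of_lt (hp.trans hq)]
  have h2 : ∑ q ∈ Finset.range l.sum,
      ∑ p ∈ Finset.range (a + q), (if Reverses (a :: l) p (a + q) then 1 else 0) =
      2 * (a / 2) * l.sum + reversalCount l := by
    simp only [Finset.sum_range_add, hcross, reverses_cons_add_add]
    rw [Finset.sum_add_distrib, Finset.sum_const, Finset.card_range, smul_eq_mul, mul_comm,
      reversalCount]
  rw [h1, h2, add_assoc]

/-- The contribution to the length of an element in stair form that depends on the order of the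
blocks. -/
def crossCount : List ℕ → ℕ
  | [] => 0
  | a :: l => 2 * (a / 2) * l.sum + crossCount l

theorem reversalCount_eq (l : List ℕ) :
    reversalCount l = (l.map fun a => reversalCount [a]).sum + crossCount l := by
  induction l with
  | nil => simp [reversalCount, crossCount]
  | cons a l ih =>
    rw [reversalCount_cons, ih, List.map_cons, List.sum_cons, crossCount]
    omega

/-- Moving `b` in front of `x` changes the count by `2 * (b / 2) * x - 2 * (x / 2) * b`, which is
nonnegative by hypothesis; equal totals force each difference to vanish. -/
theorem crossCount_middle_le (u v : List ℕ) (b : ℕ)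
    (h : ∀ x ∈ u, 2 * (x / 2) * b ≤ 2 * (b / 2) * x) :
    crossCount (u ++ b :: v) ≤ crossCount (b :: (u ++ v)) ∧
      (crossCount (u ++ b :: v) = crossCount (b :: (u ++ v)) →
        ∀ x ∈ u, 2 * (b / 2) * x ≤ 2 * (x / 2) * b) := by
  induction u with
  | nil => simp
  | cons x u ih =>
    obtain ⟨h1, h2⟩ := ih fun y hy => h y (by simp [hy])
    have hx := h x (by simp)
    simp only [List.cons_append, crossCount, List.sum_cons, List.sum_append, mul_add] at *
    refine ⟨by omega, fun he y hy => ?_⟩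
    rcases List.mem_cons.1 hy with rfl | hy
    · omega
    · exact h2 (by omega) y hy

/-- Move the head of `l'` to the front of `l`, then compare the tails by induction. Equality has to
hold in both stages, and this returns the pairwise relation for `l`. -/
theorem crossCount_le_of_perm {l l' : List ℕ} (hp : l.Perm l')
    (h : l'.Pairwise fun a b => 2 * (b / 2) * a ≤ 2 * (a / 2) * b) :
    crossCount l ≤ crossCount l' ∧ (crossCount l = crossCount l' →
      l.Pairwise fun a b => 2 * (b / 2) * a ≤ 2 * (a / 2) * b) := by
  induction l' generalizing l with
  | nil => rw [List.perm_nil] at hp; simp [hp]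
  | cons b t ih =>
    obtain ⟨u, v, rfl⟩ := List.append_of_mem (hp.mem_iff.2 (List.mem_cons_self (a := b)))
    have hp' : (u ++ v).Perm t := (List.perm_middle.symm.trans hp).cons_inv
    rw [List.pairwise_cons] at h
    obtain ⟨h1, h2⟩ := ih hp' h.2
    obtain ⟨h3, h4⟩ := crossCount_middle_le u v b fun x hx =>
      h.1 x (hp'.mem_iff.1 (List.mem_append_left v hx))
    have h5 : crossCount (b :: (u ++ v)) ≤ crossCount (b :: t) := by
      rw [crossCount, crossCount, hp'.sum_eq]
      omega
    refine ⟨h3.trans h5, fun he => ?_⟩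
    have h6 : crossCount (u ++ v) = crossCount t := by
      have : crossCount (b :: (u ++ v)) = crossCount (b :: t) := by omega
      rw [crossCount, crossCount, hp'.sum_eq] at this
      omega
    have h7 := h4 (by omega)
    have h8 := List.pairwise_append.1 (h2 h6)
    refine List.pairwise_append.2 ⟨h8.1, List.pairwise_cons.2 ⟨fun y hy => ?_, h8.2.1⟩, ?_⟩
    · exact h.1 y (hp'.mem_iff.1 (List.mem_append_right u hy))
    · intro x hx y hy
      rcases List.mem_cons.1 hy with rfl | hy
      · exact h7 x hx
      · exact h8.2.2 x hx y hy

/-- The relation on positive parts that a maximal composition satisfies pairwise. -/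
def PartRel (a b : ℕ) : Prop := Even a ∨ (Odd a ∧ Odd b ∧ b ≤ a)

theorem partRel_iff {a b : ℕ} (hb : 0 < b) :
    PartRel a b ↔ 2 * (b / 2) * a ≤ 2 * (a / 2) * b := by
  rcases Nat.even_or_odd' a with ⟨k, rfl | rfl⟩ <;> rcases Nat.even_or_odd' b with ⟨m, rfl | rfl⟩
  · have h1 : 2 * k / 2 = k := by omega
    have h2 : 2 * m / 2 = m := by omega
    simp only [PartRel, even_two_mul, true_or, true_iff, h1, h2]
    exact (mul_comm _ _).le
  · have h1 : 2 * k / 2 = k := by omega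
    have h2 : (2 * m + 1) / 2 = m := by omega
    simp only [PartRel, even_two_mul, true_or, true_iff, h1, h2]
    nlinarith
  · have h1 : (2 * k + 1) / 2 = k := by omega
    have h2 : 2 * m / 2 = m := by omega
    simp only [PartRel, h1, h2]
    constructor
    · rintro (h | ⟨-, h, -⟩)
      · rw [Nat.even_iff] at h; omega
      · rw [Nat.odd_iff] at h; omega
    · intro h; nlinarith
  · have h1 : (2 * k + 1) / 2 = k := by omega
    have h2 : (2 * m + 1) / 2 = m := by omega
    have h3 : ¬ Even (2 * k + 1) := by rw [Nat.even_iff]; omega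
    have h4 : Odd (2 * k + 1) := ⟨k, rfl⟩
    have h5 : Odd (2 * m + 1) := ⟨m, rfl⟩
    simp only [PartRel, h1, h2, h3, h4, h5, true_and, false_or]
    constructor <;> intro h <;> nlinarith

theorem IsMaximal.pairwise {n : ℕ} {α : Composition n} (h : IsMaximal α) :
    α.blocks.Pairwise PartRel := by
  obtain ⟨k, -, h1, h2, h3⟩ := h
  rw [List.pairwise_iff_get]
  intro i j hij
  rcases lt_or_ge (i : ℕ) k with hi | hi
  · exact Or.inl (h1 i hi)
  · exact Or.inr ⟨h2 i hi, h2 j (hi.trans hij.le), h3 i j hi hij.le⟩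

theorem pairwise_partRel_iff {l : List ℕ} (hl : ∀ a ∈ l, 0 < a) :
    l.Pairwise PartRel ↔ l.Pairwise fun a b => 2 * (b / 2) * a ≤ 2 * (a / 2) * b :=
  List.Pairwise.iff_of_mem fun {_ b} _ hb => partRel_iff (hl b hb)

theorem length_stairForm_le {n : ℕ} {α β : Composition n} (hp : β.blocks.Perm α.blocks)
    (h : α.blocks.Pairwise PartRel) :
    length (stairForm β) ≤ length (stairForm α) ∧
      (length (stairForm β) = length (stairForm α) → β.blocks.Pairwise PartRel) := by
  have hα := (pairwise_partRel_iff fun a ha => α.blocks_pos ha).1 h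
  rw [pairwise_partRel_iff fun a ha => β.blocks_pos ha]
  obtain ⟨h1, h2⟩ := crossCount_le_of_perm hp hα
  rw [length_eq_inversionCount, length_eq_inversionCount, inversionCount_stairForm,
    inversionCount_stairForm, reversalCount_eq, reversalCount_eq α.blocks,
    (hp.map fun a => reversalCount [a]).sum_eq]
  exact ⟨by omega, fun he => h2 (by omega)⟩

/-! ### Orbits of stair forms and recovery of the composition -/

/-- The first position of the block that contains a given position. -/
def blockStart : List ℕ → ℕ → ℕ
  | [], _ => 0
  | a :: l, p => if p < a then 0 else a + blockStart l (p - a)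

/-- The size of the block that contains a given position. -/
def blockSize : List ℕ → ℕ → ℕ
  | [], _ => 0
  | a :: l, p => if p < a then a else blockSize l (p - a)

theorem blockStart_le {l : List ℕ} {p : ℕ} : blockStart l p ≤ p := by
  induction l generalizing p with
  | nil => simp [blockStart]
  | cons a l ih =>
    rw [blockStart]
    have := ih (p := p - a)
    split_ifs <;> omega

theorem lt_blockStart_add {l : List ℕ} {p : ℕ} (h : p < l.sum) :
    p < blockStart l p + blockSize l p ∧ blockStart l p + blockSize l p ≤ l.sum := by
  induction l generalizing p with
  | nil => simp at h
  | cons a l ih =>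
    rw [List.sum_cons] at *
    rw [blockStart, blockSize]
    split_ifs with h1
    · omega
    · have := ih (p := p - a) (by omega)
      omega

theorem blockSize_mem {l : List ℕ} {p : ℕ} (h : p < l.sum) : blockSize l p ∈ l := by
  induction l generalizing p with
  | nil => simp at h
  | cons a l ih =>
    rw [List.sum_cons] at h
    rw [blockSize]
    split_ifs with h1
    · simp
    · exact List.mem_cons_of_mem _ (ih (by omega))

theorem blockSucc_eq {l : List ℕ} {p : ℕ} (h : p < l.sum) :
    blockSucc l p = if p + 1 = blockStart l p + blockSize l p then blockStart l p else p + 1 := by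
  induction l generalizing p with
  | nil => simp at h
  | cons a l ih =>
    rw [List.sum_cons] at h
    rw [blockSucc, blockStart, blockSize]
    split_ifs with h1 h2 h3 h3 h3
    any_goals omega
    · rw [ih (by omega), if_pos (by omega)]
    · rw [ih (by omega), if_neg (by omega)]; omega

theorem block_eq_of_mem {l : List ℕ} {p q : ℕ} (h : p < l.sum) (h1 : blockStart l p ≤ q)
    (h2 : q < blockStart l p + blockSize l p) :
    blockStart l q = blockStart l p ∧ blockSize l q = blockSize l p := by
  induction l generalizing p q with
  | nil => simp at h
  | cons a l ih =>
    rw [List.sum_cons] at h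
    simp only [blockStart, blockSize] at *
    split_ifs at h1 h2 with h3
    · have hq : q < a := by omega
      simp [hq, h3]
    · have hq : ¬ q < a := by omega
      rw [if_neg hq, if_neg hq, if_neg h3, if_neg h3]
      have := ih (p := p - a) (q := q - a) (by omega) (by omega) (by omega)
      omega

theorem mem_orbit_zpowers_iff {X : Type*} {w : Perm X} {x y : X} :
    y ∈ MulAction.orbit (Subgroup.zpowers w) x ↔ w.SameCycle x y := by
  rw [MulAction.mem_orbit_iff]
  constructor
  · rintro ⟨⟨_, i, rfl⟩, h⟩
    exact ⟨i, h⟩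
  · rintro ⟨i, h⟩
    exact ⟨⟨w ^ i, i, rfl⟩, h⟩

theorem mem_orbit_stairForm_iff {n : ℕ} (α : Composition n) (p q : Fin n) :
    stairEntry q ∈ MulAction.orbit (Subgroup.zpowers (stairForm α)) (stairEntry p) ↔
      blockStart α.blocks p ≤ q ∧ (q : ℕ) < blockStart α.blocks p + blockSize α.blocks p := by
  have hlt : ∀ r : Fin n, (r : ℕ) < α.blocks.sum := fun r => by rw [α.blocks_sum]; exact r.isLt
  have hb : ∀ r : Fin n, blockSucc α.blocks r < n := fun r => by
    simpa [α.blocks_sum] using blockSucc_lt (hlt r)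
  rw [mem_orbit_zpowers_iff]
  constructor
  · intro h
    have key : ∀ i : ℕ, ∃ r : Fin n, (stairForm α ^ i) (stairEntry p) = stairEntry r ∧
        blockStart α.blocks r = blockStart α.blocks p ∧
        blockSize α.blocks r = blockSize α.blocks p := by
      intro i
      induction i with
      | zero => exact ⟨p, rfl, rfl, rfl⟩
      | succ i ih =>
        obtain ⟨r, hr, h1, h2⟩ := ih
        refine ⟨⟨_, hb r⟩, ?_, ?_⟩
        · rw [pow_succ', Perm.mul_apply, hr, stairForm_apply α (q := ⟨_, hb r⟩) rfl]
        · rw [← h1, ← h2]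
          have h3 := lt_blockStart_add (hlt r)
          have h4 := blockStart_le (l := α.blocks) (p := r)
          refine block_eq_of_mem (hlt r) ?_ ?_ <;> simp only [blockSucc_eq (hlt r)] <;>
            split_ifs <;> omega
    obtain ⟨i, -, hi⟩ := h.exists_pow_eq'
    obtain ⟨r, hr, h1, h2⟩ := key i
    rw [← stairEntry_injective (hr.symm.trans hi), ← h1, ← h2]
    exact ⟨blockStart_le, (lt_blockStart_add (hlt r)).1⟩
  · rintro ⟨h1, h2⟩
    have hs : blockStart α.blocks p < n := (blockStart_le).trans_lt p.isLt
    have key : ∀ k : ℕ, ∀ r : Fin n, (r : ℕ) = blockStart α.blocks p + k →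
        (r : ℕ) < blockStart α.blocks p + blockSize α.blocks p →
        (stairForm α).SameCycle (stairEntry ⟨_, hs⟩) (stairEntry r) := by
      intro k
      induction k with
      | zero =>
        intro r hr _
        rw [Fin.ext (b := ⟨_, hs⟩) hr]
      | succ k ih =>
        intro r hr hr'
        have hr2 := r.isLt
        obtain ⟨t, ht⟩ : ∃ t : Fin n, (t : ℕ) = blockStart α.blocks p + k :=
          ⟨⟨blockStart α.blocks p + k, by omega⟩, rfl⟩
        obtain ⟨e1, e2⟩ := block_eq_of_mem (hlt p) (q := t) (by omega) (by omega)
        rw [← stairForm_apply α (p := t) (q := r), Perm.sameCycle_apply_right]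
        · exact ih t ht (by omega)
        · rw [blockSucc_eq (hlt t), e1, e2, if_neg (by omega)]; omega
    have hp := lt_blockStart_add (hlt p)
    have hp' := blockStart_le (l := α.blocks) (p := p)
    exact (key (p - blockStart α.blocks p) p (by omega) (by omega)).symm.trans
      (key (q - blockStart α.blocks p) q (by omega) (by omega))

theorem ncard_orbit_stairForm {n : ℕ} (α : Composition n) (p : Fin n) :
    (MulAction.orbit (Subgroup.zpowers (stairForm α)) (stairEntry p)).ncard =
      blockSize α.blocks p := by
  have hp := lt_blockStart_add (l := α.blocks) (p := p) (by rw [α.blocks_sum]; exact p.isLt)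
  rw [α.blocks_sum] at hp
  have h1 : MulAction.orbit (Subgroup.zpowers (stairForm α)) (stairEntry p) =
      stairEntry '' {q : Fin n | blockStart α.blocks p ≤ q ∧
        (q : ℕ) < blockStart α.blocks p + blockSize α.blocks p} := by
    ext v
    obtain ⟨q, rfl⟩ := stairEntry_surjective v
    rw [mem_orbit_stairForm_iff, stairEntry_injective.mem_set_image, Set.mem_ofPred_eq]
  rw [h1, Set.ncard_image_of_injective _ stairEntry_injective,
    ← Set.ncard_image_of_injective _ Fin.val_injective]
  have h2 : Fin.val '' {q : Fin n | blockStart α.blocks p ≤ q ∧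
      (q : ℕ) < blockStart α.blocks p + blockSize α.blocks p} =
      (Finset.Ico (blockStart α.blocks p) (blockStart α.blocks p + blockSize α.blocks p) :
        Finset ℕ) := by
    ext v
    simp only [Set.mem_image, Set.mem_ofPred_eq, Finset.coe_Ico, Set.mem_Ico]
    constructor
    · rintro ⟨q, h, rfl⟩; exact h
    · exact fun h => ⟨⟨v, by omega⟩, h, rfl⟩
  rw [h2, Set.ncard_coe_finset, Nat.card_Ico, Nat.add_sub_cancel_left]

theorem sum_blockSize_eq (l : List ℕ) (k : ℕ) :
    ∑ p ∈ Finset.range l.sum, (if blockSize l p = k then 1 else 0) = k * l.count k := by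
  induction l with
  | nil => simp
  | cons a l ih =>
    have h1 : ∑ p ∈ Finset.range a, (if blockSize (a :: l) p = k then 1 else 0) =
        if a = k then a else 0 := by
      rw [Finset.sum_congr rfl (g := fun _ => if a = k then 1 else 0)]
      · split_ifs <;> simp
      · intro p hp
        rw [blockSize, if_pos (Finset.mem_range.1 hp)]
    have h2 : ∀ p, blockSize (a :: l) (a + p) = blockSize l p := fun p => by
      rw [blockSize, if_neg (by omega), Nat.add_sub_cancel_left]
    simp only [List.sum_cons, Finset.sum_range_add, h1, h2, ih, List.count_cons, beq_iff_eq]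
    split_ifs with h
    · rw [h]; ring
    · ring

theorem orbit_conj {X : Type*} (c w : Perm X) (x : X) :
    MulAction.orbit (Subgroup.zpowers (c * w * c⁻¹)) (c x) =
      c '' MulAction.orbit (Subgroup.zpowers w) x := by
  ext v
  obtain ⟨y, rfl⟩ := c.surjective v
  rw [c.injective.mem_set_image, mem_orbit_zpowers_iff, mem_orbit_zpowers_iff,
    Perm.sameCycle_conj]
  simp

/-- The entries in orbits of size `k` number `k` times the multiplicity of `k` among the parts, and
conjugation preserves orbit sizes. -/
theorem blocks_perm_of_isConj {n : ℕ} {α β : Composition n}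
    (h : IsConj (stairForm α) (stairForm β)) : α.blocks.Perm β.blocks := by
  obtain ⟨c, hc⟩ := isConj_iff.1 h
  rw [List.perm_iff_count]
  intro k
  rcases Nat.eq_zero_or_pos k with rfl | hk
  · rw [List.count_eq_zero_of_not_mem fun hm => lt_irrefl _ (α.blocks_pos hm),
      List.count_eq_zero_of_not_mem fun hm => lt_irrefl _ (β.blocks_pos hm)]
  have key : ∀ γ : Composition n, ∑ v : Fin n,
      (if (MulAction.orbit (Subgroup.zpowers (stairForm γ)) v).ncard = k then 1 else 0) =
        k * γ.blocks.count k := by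
    intro γ
    rw [← sum_blockSize_eq, γ.blocks_sum, ← Fin.sum_univ_eq_sum_range
      (fun p => if blockSize γ.blocks p = k then 1 else 0),
      ← (Finite.injective_iff_bijective.1 (stairEntry_injective (n := n))).sum_comp]
    simp only [ncard_orbit_stairForm]
  refine Nat.eq_of_mul_eq_mul_left hk ?_
  rw [← key, ← key, ← hc]
  conv_rhs => rw [← Equiv.sum_comp c]
  simp only [orbit_conj, Set.ncard_image_of_injective _ c.injective]

theorem evenOrbits_conj {n : ℕ} (c w : Perm (Fin n)) :
    evenOrbits (c * w * c⁻¹) = (fun O => c '' O) '' evenOrbits w := by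
  ext O
  simp only [evenOrbits, orbits, Set.mem_ofPred_eq, Set.mem_range, Set.mem_image]
  constructor
  · rintro ⟨⟨x, rfl⟩, h⟩
    obtain ⟨y, rfl⟩ := c.surjective x
    rw [orbit_conj, Set.ncard_image_of_injective _ c.injective] at h
    exact ⟨_, ⟨⟨y, rfl⟩, h⟩, (orbit_conj c w y).symm⟩
  · rintro ⟨_, ⟨⟨x, rfl⟩, h⟩, rfl⟩
    exact ⟨⟨c x, orbit_conj c w x⟩, by rwa [Set.ncard_image_of_injective _ c.injective]⟩

theorem orbit_eq_of_evenOrbits_eq {n : ℕ} {w w' : Perm (Fin n)} (h : evenOrbits w = evenOrbits w')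
    (v : Fin n) (hv : Even (MulAction.orbit (Subgroup.zpowers w) v).ncard) :
    MulAction.orbit (Subgroup.zpowers w') v = MulAction.orbit (Subgroup.zpowers w) v := by
  have hm : MulAction.orbit (Subgroup.zpowers w) v ∈ evenOrbits w' := h ▸ ⟨⟨v, rfl⟩, hv⟩
  obtain ⟨⟨x, hx⟩, -⟩ := hm
  rw [← hx, MulAction.orbit_eq_iff]
  have hx' : MulAction.orbit (Subgroup.zpowers w') x = MulAction.orbit (Subgroup.zpowers w) v := hx
  rw [hx']
  exact MulAction.mem_orbit_self v

theorem pairwise_ge_of_odd {a : ℕ} {l : List ℕ} (ha : Odd a) (h : (a :: l).Pairwise PartRel) :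
    (∀ b ∈ a :: l, Odd b) ∧ (a :: l).Pairwise (· ≥ ·) := by
  have h1 : ∀ b ∈ a :: l, Odd b := by
    intro b hb
    rcases List.mem_cons.1 hb with rfl | hb
    · exact ha
    · rcases (List.pairwise_cons.1 h).1 b hb with h2 | h2
      · exact absurd h2 (Nat.not_even_iff_odd.2 ha)
      · exact h2.2.1
  refine ⟨h1, h.imp_of_mem fun {b c} hb _ hbc => ?_⟩
  rcases hbc with h2 | h2
  · exact absurd h2 (Nat.not_even_iff_odd.2 (h1 b hb))
  · exact h2.2.2

/-- Even heads must agree because both cover position `0`. From the first odd head on, both lists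
consist of odd parts in decreasing order, so the permutation relation alone identifies them. -/
theorem eq_of_perm_of_blockSize_eq {l l' : List ℕ} (hp : l.Perm l') (hpos : ∀ a ∈ l, 0 < a)
    (h : l.Pairwise PartRel) (h' : l'.Pairwise PartRel)
    (he : ∀ p < l.sum, Even (blockSize l p) → blockSize l' p = blockSize l p)
    (he' : ∀ p < l.sum, Even (blockSize l' p) → blockSize l p = blockSize l' p) : l = l' := by
  induction l generalizing l' with
  | nil => exact (List.nil_perm.1 hp).symm
  | cons a t ih =>
    cases l' with
    | nil => exact List.perm_nil.1 hp
    | cons b t' =>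
      have ha := hpos a (by simp)
      have hb := hpos b (hp.mem_iff.2 (by simp))
      have he0 := he 0 (by simp; omega)
      have he0' := he' 0 (by simp; omega)
      simp only [blockSize, if_pos ha, if_pos hb] at he0 he0'
      rcases Nat.even_or_odd a with hae | hao
      · have hab := he0 hae
        subst hab
        have hs : ∀ (s : List ℕ) p, blockSize (b :: s) (b + p) = blockSize s p := fun s p => by
          rw [blockSize, if_neg (by omega), Nat.add_sub_cancel_left]
        rw [ih hp.cons_inv (fun x hx => hpos x (by simp [hx])) (List.pairwise_cons.1 h).2
          (List.pairwise_cons.1 h').2]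
        · intro p hp2
          have := he (b + p) (by simp; omega)
          rwa [hs, hs] at this
        · intro p hp2
          have := he' (b + p) (by simp; omega)
          rwa [hs, hs] at this
      · have hbo : Odd b := by
          rw [← Nat.not_even_iff_odd]
          intro hbe
          have := he0' hbe
          subst this
          exact (Nat.not_even_iff_odd.2 hao) hbe
        exact hp.eq_of_pairwise (fun x y _ _ h1 h2 => le_antisymm h2 h1)
          (pairwise_ge_of_odd hao h).2 (pairwise_ge_of_odd hbo h').2

/-- Compositions whose parts are arranged as in a maximal one are determined by the conjugacy
class and the even orbits of their elements in stair form. -/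
theorem eq_of_evenOrbits_stairForm_eq {n : ℕ} {α β : Composition n}
    (h : α.blocks.Pairwise PartRel) (h' : β.blocks.Pairwise PartRel)
    (hc : IsConj (stairForm α) (stairForm β))
    (he : evenOrbits (stairForm α) = evenOrbits (stairForm β)) : α = β := by
  ext1
  have key : ∀ γ δ : Composition n, evenOrbits (stairForm γ) = evenOrbits (stairForm δ) →
      ∀ p < n, Even (blockSize γ.blocks p) → blockSize δ.blocks p = blockSize γ.blocks p := by
    intro γ δ hγδ p hp hpe
    have h1 := ncard_orbit_stairForm γ ⟨p, hp⟩
    have h2 := ncard_orbit_stairForm δ ⟨p, hp⟩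
    simp only at h1 h2
    rw [← h1] at hpe ⊢
    rw [← h2, orbit_eq_of_evenOrbits_eq hγδ _ hpe]
  refine eq_of_perm_of_blockSize_eq (blocks_perm_of_isConj hc) (fun a ha => α.blocks_pos ha) h h'
    ?_ ?_ <;> rw [α.blocks_sum]
  · exact key α β he
  · exact key β α he.symm

/-! ### The level function and invariance of even orbits -/

/-- A level of the stair positions. It is `0` from the first odd block on; on an even block it
takes two opposite values, whose absolute value is larger for earlier blocks. -/
def stairLevel : List ℕ → ℕ → ℤ
  | [], _ => 0
  | a :: l, p =>
    if Odd a then 0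
    else if p < a then (if Even p then -(l.length + 1 : ℤ) else l.length + 1)
    else stairLevel l (p - a)

theorem abs_stairLevel_le (l : List ℕ) (p : ℕ) : |stairLevel l p| ≤ l.length := by
  induction l generalizing p with
  | nil => simp [stairLevel]
  | cons a l ih =>
    have := ih (p - a)
    rw [stairLevel, List.length_cons]
    rw [abs_le] at *
    push_cast
    split_ifs <;> omega

/-- A position in an even block has absolute level at least that of every later position, and its
sign follows its parity. With `stairEntry_lt_iff` this makes the level monotone in the entry. -/
theorem stairLevel_mono {l : List ℕ} {p q : ℕ} (h : p < q) :
    (Even p → stairLevel l p ≤ stairLevel l q) ∧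
      (¬ Even p → stairLevel l q ≤ stairLevel l p) := by
  induction l generalizing p q with
  | nil => simp [stairLevel]
  | cons a l ih =>
    have h1 := abs_stairLevel_le l (q - a)
    rw [abs_le] at h1
    rw [stairLevel, stairLevel]
    by_cases ha : Odd a
    · simp [ha]
    rw [if_neg ha, if_neg ha]
    by_cases hp : p < a
    · rw [if_pos hp]
      constructor <;> intro hpe <;> simp only [hpe, if_true, if_false] <;> split_ifs <;> omega
    · rw [if_neg hp, if_neg (by omega)]
      have h2 := ih (p := p - a) (q := q - a) (by omega)
      have h3 : Even (p - a) ↔ Even p := by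
        rw [Nat.even_sub (by omega)]
        simp [Nat.not_odd_iff_even.1 ha]
      rwa [h3] at h2

/-- The cycle of an even block alternates parity, the return to its start included; an odd block has
level `0`. -/
theorem stairLevel_blockSucc {l : List ℕ} {p : ℕ} (h : p < l.sum) :
    stairLevel l (blockSucc l p) = -stairLevel l p := by
  induction l generalizing p with
  | nil => simp at h
  | cons a l ih =>
    rw [List.sum_cons] at h
    by_cases ha : Odd a
    · simp [stairLevel, ha]
    by_cases hp : p < a
    · rw [blockSucc_cons_of_lt hp]
      simp only [stairLevel, if_neg ha, if_pos hp]
      rw [Nat.odd_iff] at ha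
      simp only [Nat.even_iff]
      split_ifs <;> omega
    · have := ih (p := p - a) (by omega)
      rw [blockSucc, if_neg hp, stairLevel, stairLevel, if_neg ha, if_neg ha, if_neg (by omega),
        if_neg hp, Nat.add_sub_cancel_left, this]

theorem blockStart_eq_of_stairLevel_eq {l : List ℕ} {p q : ℕ} (h : l.Pairwise PartRel)
    (hp : p < l.sum) (hpe : Even (blockSize l p)) (he : stairLevel l p = stairLevel l q) :
    blockStart l q = blockStart l p := by
  induction l generalizing p q with
  | nil => simp at hp
  | cons a l ih =>
    by_cases ha : Odd a
    · exact absurd hpe (Nat.not_even_iff_odd.2 ((pairwise_ge_of_odd ha h).1 _ (blockSize_mem hp)))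
    rw [List.sum_cons] at hp
    have h1 := abs_le.1 (abs_stairLevel_le l (p - a))
    have h2 := abs_le.1 (abs_stairLevel_le l (q - a))
    rw [stairLevel, stairLevel, if_neg ha, if_neg ha] at he
    rw [blockStart, blockStart]
    by_cases hpa : p < a
    · rw [if_pos hpa] at he ⊢
      rw [if_pos]
      by_contra hqa
      rw [if_neg hqa] at he
      split_ifs at he <;> omega
    · rw [if_neg hpa] at he ⊢
      have hqa : ¬ q < a := by
        intro hqa
        rw [if_pos hqa] at he
        split_ifs at he <;> omega
      rw [if_neg hqa] at he ⊢
      rw [blockSize, if_neg hpa] at hpe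
      rw [ih (List.pairwise_cons.1 h).2 (by omega) hpe he]

/-- The data about a permutation that cyclic shifts of constant length preserve: it negates the
level function `f`, and its even orbits are unions of level sets. -/
def RespectsLevel {n : ℕ} (f : Fin n → ℤ) (w : Perm (Fin n)) : Prop :=
  (∀ v, f (w v) = -f v) ∧ ∀ O ∈ evenOrbits w, ∀ u v, f u = f v → u ∈ O → v ∈ O

theorem RespectsLevel.step {n : ℕ} {f : Fin n → ℤ} (hf : Monotone f) {w w' : Perm (Fin n)}
    (hw : RespectsLevel f w) (hs : Step w w') (hl : length w' = length w) :
    RespectsLevel f w' ∧ evenOrbits w' = evenOrbits w := by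
  obtain ⟨h1, h2⟩ := hw
  obtain ⟨_, ⟨i, j, hij, rfl⟩, rfl, -⟩ := hs
  have hle : i ≤ j := by rw [Fin.le_def]; omega
  rcases (hf hle).lt_or_eq with hlt | heq
  · have hinv : ∀ v, f (w⁻¹ v) = -f v := fun v => by
      have := h1 (w⁻¹ v)
      rw [show w (w⁻¹ v) = v by simp] at this
      omega
    have h3 : w j < w i := hf.reflect_lt (by rw [h1, h1]; omega)
    have h4 : w⁻¹ j < w⁻¹ i := hf.reflect_lt (by rw [hinv, hinv]; omega)
    rcases conj_swap_eq_or_length_lt hij w h3 h4 with h | h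
    · rw [h]
      exact ⟨⟨h1, h2⟩, rfl⟩
    · omega
  · have hfs : ∀ v, f (swap i j v) = f v := by
      intro v
      rw [swap_apply_def]
      split_ifs with h3 h3
      · rw [h3, heq]
      · rw [h3, heq]
      · rfl
    have he : evenOrbits (swap i j * w * swap i j) = evenOrbits w := by
      have hc := evenOrbits_conj (swap i j) w
      rw [swap_inv] at hc
      rw [hc]
      -- An even orbit is a union of level sets, each of which the transposition preserves by `hfs`.
      refine (Set.image_congr fun O hO => ?_).trans (Set.image_id' _)
      ext v
      rw [Equiv.image_eq_preimage_symm, Set.mem_preimage, symm_swap]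
      exact ⟨h2 O hO _ _ (hfs v), h2 O hO _ _ (hfs v).symm⟩
    exact ⟨⟨fun v => by rw [Perm.mul_apply, Perm.mul_apply, hfs, h1, hfs], he ▸ h2⟩, he⟩

theorem Shift.length_le {n : ℕ} {w w' : Perm (Fin n)} (h : Shift w w') :
    length w' ≤ length w := by
  induction h with
  | refl => exact le_rfl
  | tail _ hs ih =>
    obtain ⟨_, _, _, h⟩ := hs
    exact h.trans ih

theorem Shift.isConj {n : ℕ} {w w' : Perm (Fin n)} (h : Shift w w') : IsConj w w' := by
  induction h with
  | refl => exact IsConj.refl _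
  | tail _ hs ih =>
    obtain ⟨_, ⟨i, j, -, rfl⟩, rfl, -⟩ := hs
    exact ih.trans (isConj_iff.2 ⟨swap i j, by rw [swap_inv]⟩)

theorem Step.symm {n : ℕ} {w w' : Perm (Fin n)} (h : Step w w') (hl : length w ≤ length w') :
    Step w' w := by
  obtain ⟨_, ⟨i, j, hij, rfl⟩, rfl, -⟩ := h
  exact ⟨_, ⟨i, j, hij, rfl⟩, by simp [mul_assoc], hl⟩

/-- Lengths weakly decrease along a shift, so the bound on the end terms makes them constant and
each step can be reversed. -/
theorem Shift.symm {n : ℕ} {w w' : Perm (Fin n)} (h : Shift w w') (hl : length w ≤ length w') :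
    Shift w' w := by
  induction h with
  | refl => exact Relation.ReflTransGen.refl
  | tail hb hs ih =>
    have h1 := Shift.length_le hb
    have h2 : length _ ≤ length _ := Shift.length_le (Relation.ReflTransGen.single hs)
    exact Relation.ReflTransGen.head (hs.symm (h1.trans hl)) (ih (hl.trans h2))

theorem RespectsLevel.shift {n : ℕ} {f : Fin n → ℤ} (hf : Monotone f) {w w' : Perm (Fin n)}
    (hw : RespectsLevel f w) (hs : Shift w w') (hl : length w' = length w) :
    RespectsLevel f w' ∧ evenOrbits w' = evenOrbits w := by
  induction hs with
  | refl => exact ⟨hw, rfl⟩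
  | tail hb hs ih =>
    have h1 := Shift.length_le hb
    have h2 : length _ ≤ length _ := Shift.length_le (Relation.ReflTransGen.single hs)
    obtain ⟨h3, h4⟩ := ih (by omega)
    obtain ⟨h5, h6⟩ := h3.step hf hs (by omega)
    exact ⟨h5, h6.trans h4⟩

theorem exists_respectsLevel_stairForm {n : ℕ} {α : Composition n}
    (h : α.blocks.Pairwise PartRel) :
    ∃ f : Fin n → ℤ, Monotone f ∧ RespectsLevel f (stairForm α) := by
  have hlt : ∀ r : Fin n, (r : ℕ) < α.blocks.sum := fun r => by rw [α.blocks_sum]; exact r.isLt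
  have hb : ∀ r : Fin n, blockSucc α.blocks r < n := fun r => by
    simpa [α.blocks_sum] using blockSucc_lt (hlt r)
  obtain ⟨f, hf⟩ : ∃ f : Fin n → ℤ, ∀ p : Fin n, f (stairEntry p) = stairLevel α.blocks p := by
    choose g hg using stairEntry_surjective (n := n)
    exact ⟨fun v => stairLevel α.blocks (g v), fun p => by
      simp only [stairEntry_injective (hg (stairEntry p))]⟩
  refine ⟨f, ?_, ?_, ?_⟩
  · intro u v huv
    obtain ⟨p, rfl⟩ := stairEntry_surjective u
    obtain ⟨q, rfl⟩ := stairEntry_surjective v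
    rw [hf, hf]
    rcases lt_trichotomy p q with hpq | rfl | hpq
    · have h1 := stairLevel_mono (l := α.blocks) (Fin.lt_def.1 hpq)
      exact h1.1 ((stairEntry_lt_iff hpq).1
        (lt_of_le_of_ne huv fun he => hpq.ne (stairEntry_injective he)))
    · exact le_rfl
    · have h1 := stairLevel_mono (l := α.blocks) (Fin.lt_def.1 hpq)
      exact h1.2 fun he => huv.not_gt ((stairEntry_lt_iff hpq).2 he)
  · intro v
    obtain ⟨p, rfl⟩ := stairEntry_surjective v
    rw [stairForm_apply α (q := ⟨_, hb p⟩) rfl, hf, hf, stairLevel_blockSucc (hlt p)]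
  · rintro O ⟨⟨x, hx⟩, hO⟩ u v huv hu
    have hO' : O = MulAction.orbit (Subgroup.zpowers (stairForm α)) u := by
      rw [← hx] at hu ⊢
      exact (MulAction.orbit_eq_iff.2 hu).symm
    obtain ⟨p, rfl⟩ := stairEntry_surjective u
    obtain ⟨q, rfl⟩ := stairEntry_surjective v
    rw [hO', ncard_orbit_stairForm] at hO
    rw [hf, hf] at huv
    have h1 := blockStart_eq_of_stairLevel_eq h (hlt p) hO huv
    have h2 := lt_blockStart_add (hlt p)
    have h3 := lt_blockStart_add (hlt q)
    have h4 := blockStart_le (l := α.blocks) (p := p)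
    have h5 := blockStart_le (l := α.blocks) (p := q)
    rw [hO', mem_orbit_stairForm_iff]
    refine ⟨by omega, ?_⟩
    by_contra hc
    have h6 := (block_eq_of_mem (hlt q) (q := p) (by omega) (by omega)).2
    omega

theorem evenOrbits_eq_of_shift_stairForm {n : ℕ} {α : Composition n}
    (h : α.blocks.Pairwise PartRel) {w : Perm (Fin n)} (hs : Shift (stairForm α) w)
    (hl : length w = length (stairForm α)) : evenOrbits w = evenOrbits (stairForm α) := by
  obtain ⟨f, hf, hr⟩ := exists_respectsLevel_stairForm h
  exact (hr.shift hf hs hl).2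

end CyclicShift

theorem mainTheorem11 (n : ℕ) (α : Composition n) (hα : CyclicShift.IsMaximal α)
    (σ : Equiv.Perm (Fin n)) :
    σ ∈ CyclicShift.stairClass α ↔
      IsConj σ (CyclicShift.stairForm α) ∧
      CyclicShift.length σ = CyclicShift.length (CyclicShift.stairForm α) ∧
      CyclicShift.evenOrbits σ = CyclicShift.evenOrbits (CyclicShift.stairForm α) := by
  constructor
  · rintro ⟨h1, h2⟩
    have hl := le_antisymm h1.length_le h2.length_le
    exact ⟨h2.isConj, hl, CyclicShift.evenOrbits_eq_of_shift_stairForm hα.pairwise h1 hl⟩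
  · rintro ⟨hc, hl, he⟩
    obtain ⟨β, hβ⟩ := CyclicShift.exists_shift_stairForm σ
    have hc' := hβ.isConj.trans hc
    obtain ⟨h1, h2⟩ := CyclicShift.length_stairForm_le
      (CyclicShift.blocks_perm_of_isConj hc') hα.pairwise
    have h3 := hβ.length_le
    -- The length of `stairForm β` lies between those of `σ` and `stairForm α`, which agree; so all
    -- three are equal.
    have h4 := h2 (by omega)
    have h5 := CyclicShift.evenOrbits_eq_of_shift_stairForm h4 hβ (by omega)
    obtain rfl := CyclicShift.eq_of_evenOrbits_stairForm_eq h4 hα.pairwise hc' (h5.symm.trans he)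
    exact ⟨hβ, hβ.symm hl.ge⟩
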